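/- Let $A$ be an $\ell\times k$ matrix whose entries are homogeneous polynomials of the same degree $d$ in $\mathbb{C}[\partial_1,\dots,\partial_n]$, where $\partial_i$ acts on distributions by partial differentiation $\partial/\partial x_i$, $(\partial_i\bullet\varphi)(f)=-\varphi(\partial f/\partial x_i)$. For $F=\mathbb{C}$ or $F=\mathbb{C}^k$, let $\mathcal{D}'(\mathbb{R}^n,F)$ denote the space of continuous $\mathbb{C}$-linear functionals on the space $C_c^\infty(\mathbb{R}^n,F)$ of test functions, with the weak-* topology (pointwise convergence on test functions); a locally integrable function $\varphi:\mathbb{R}^n\to\mathbb{C}^k$ is identified with the distribution $f\mapsto\int\sum_j f_j\varphi_j\,dx$. For $u\in\mathbb{C}^k$ and a real linear subspace $\pi\subseteq\mathbb{R}^n$, call $(u,\pi)$ a *wave pair* for $A$ if $A(\xi)u=0$ for all $\xi\in\pi$. The *classical wave solutions* attached to $(u,\pi)$ are the finite superpositions $\sum_{j=1}^p\lambda_j\exp(i\,\xi_j\cdot x)\,u$ with $\lambda_j\in\mathbb{C}$ and $\xi_j\in\pi$; the *wave solutions* attached to $(u,\pi)$ are the elements of the closure of this set in $\mathcal{D}'(\mathbb{R}^n,\mathbb{C}^k)$.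 Let $r=\operatorname{codim}\pi$, and let $L_1,\dots,L_{n-r}$ be linear forms on $\mathbb{R}^n$ with $\pi^\perp=\{x\in\mathbb{R}^n: L_1(x)=\cdots=L_{n-r}(x)=0\}$; write $L$ for the $(n-r)\times n$ matrix of their coefficients. For $\delta\in\mathcal{D}'(\mathbb{R}^{n-r},\mathbb{C})$, let $\delta(L_1(x),\dots,L_{n-r}(x))\in\mathcal{D}'(\mathbb{R}^n,\mathbb{C})$ be the distribution $f\mapsto\delta(g_f)$, where $$g_f(y)=\frac1{\sqrt{\det(LL^T)}}\int_{\mathbb{R}^r} f\Bigl(L^T(LL^T)^{-1}y+\sum_{i=1}^r t_iv_i\Bigr)\,dt$$ and $v_1,\dots,v_r$ is an orthonormal basis of $\ker L$ (for smooth $\delta$ this is the composition $\delta\circ L$). 1. If $(u,\pi)$ is a wave pair for $A$, then the wave solutions attached to $(u,\pi)$ are precisely the distributions $\delta(L_1(x),\dots,L_{n-r}(x))\cdot u$ with $\delta\in\mathcal{D}'(\mathbb{R}^{n-r},\mathbb{C})$ arbitrary. 2. $(u,\pi)$ is a wave pair for $A$ if and only if $\varphi(x)=\delta(L_1(x),\dots,L_{n-r}(x))\cdot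 u$ satisfies $A\bullet\varphi=0$ for every $\delta\in\mathcal{D}'(\mathbb{R}^{n-r},\mathbb{C})$. -/

import Mathlib

namespace WavePairs

noncomputable section

open MeasureTheory TopologicalSpace
open scoped ContDiff

set_option linter.unusedSectionVars false


/-- The integral of `f` over the affine subspace `M y + range N`, parametrised by `N`. -/
def affineIntegral {V Y Z F : Type} [NormedAddCommGroup V] [NormedSpace ℝ V]
    [NormedAddCommGroup Y] [NormedSpace ℝ Y] [NormedAddCommGroup Z] [NormedSpace ℝ Z]
    [MeasureSpace Z] [NormedAddCommGroup F] [NormedSpace ℝ F]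
    (M : Y →L[ℝ] V) (N : Z →L[ℝ] V) (f : V → F) (y : Y) : F :=
  ∫ t : Z, f (M y + N t)

section AffineIntegral

variable {V Y Z F : Type} [NormedAddCommGroup V] [NormedSpace ℝ V]
  [NormedAddCommGroup Y] [NormedSpace ℝ Y] [NormedAddCommGroup Z] [NormedSpace ℝ Z]
  [FiniteDimensional ℝ Z] [MeasureSpace Z] [BorelSpace Z]
  [IsFiniteMeasureOnCompacts (volume : Measure Z)]
  [NormedAddCommGroup F] [NormedSpace ℝ F] [CompleteSpace F]
  {M : Y →L[ℝ] V} {N : Z →L[ℝ] V} {Q : V →L[ℝ] Z}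

theorem affine_eq_zero (hQM : ∀ y, Q (M y) = 0) (hQN : ∀ t, Q (N t) = t) {K : Set V}
    {f : V → F} (hf : ∀ x, x ∉ K → f x = 0) (y : Y) {t : Z} (ht : t ∉ Q '' K) :
    f (M y + N t) = 0 :=
  hf _ fun h => ht ⟨_, h, by simp [hQM, hQN]⟩

theorem integrable_affine (hQM : ∀ y, Q (M y) = 0) (hQN : ∀ t, Q (N t) = t) {K : Set V}
    (hK : IsCompact K) {f : V → F} (hc : Continuous f) (hf : ∀ x, x ∉ K → f x = 0) (y : Y) :
    Integrable (fun t : Z => f (M y + N t)) := by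
  refine Continuous.integrable_of_hasCompactSupport (by fun_prop) ?_
  exact HasCompactSupport.intro (hK.image Q.continuous) fun t ht => affine_eq_zero hQM hQN hf y ht

theorem norm_affineIntegral_le (hQM : ∀ y, Q (M y) = 0) (hQN : ∀ t, Q (N t) = t) {K : Set V}
    (hK : IsCompact K) {f : V → F} (hf : ∀ x, x ∉ K → f x = 0)
    {B : ℝ} (hB : ∀ x, ‖f x‖ ≤ B) (y : Y) :
    ‖affineIntegral M N f y‖ ≤ B * volume.real (Q '' K) := by
  have hQK := hK.image Q.continuous
  rw [affineIntegral, ← setIntegral_eq_integral_of_forall_compl_eq_zero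
    (s := Q '' K) fun t ht => affine_eq_zero hQM hQN hf y ht]
  exact norm_setIntegral_le_of_norm_le_const hQK.measure_lt_top fun t _ => hB _

theorem hasFDerivAt_affineIntegral (hQM : ∀ y, Q (M y) = 0) (hQN : ∀ t, Q (N t) = t) {K : Set V}
    (hK : IsCompact K) {f : V → F} (hc : ContDiff ℝ 1 f) (hf : ∀ x, x ∉ K → f x = 0)
    (hf' : ∀ x, x ∉ K → fderiv ℝ f x = 0) (y : Y) :
    HasFDerivAt (affineIntegral M N f) ((affineIntegral M N (fderiv ℝ f) y).comp M) y := by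
  have hc' : Continuous (fderiv ℝ f) := hc.continuous_fderiv one_ne_zero
  obtain ⟨B, hB⟩ : ∃ B, ∀ x, ‖fderiv ℝ f x‖ ≤ B :=
    hc'.bounded_above_of_compact_support (HasCompactSupport.intro hK hf')
  have hB0 : 0 ≤ B := (norm_nonneg _).trans (hB 0)
  have hQK := hK.image Q.continuous
  have hi := integrable_affine hQM hQN hK hc' hf' y
  have e : (affineIntegral M N (fderiv ℝ f) y).comp M
      = ∫ t : Z, (fderiv ℝ f (M y + N t)).comp M :=
    (((ContinuousLinearMap.compL ℝ Y V F).flip M).integral_comp_comm hi).symm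
  rw [e]
  refine hasFDerivAt_integral_of_dominated_of_fderiv_le
    (F := fun y t => f (M y + N t)) (F' := fun y t => (fderiv ℝ f (M y + N t)).comp M)
    (bound := (Q '' K).indicator fun _ => B * ‖M‖) Filter.univ_mem
    (.of_forall fun y => (integrable_affine hQM hQN hK hc.continuous hf y).aestronglyMeasurable)
    (integrable_affine hQM hQN hK hc.continuous hf y)
    (((ContinuousLinearMap.compL ℝ Y V F).flip M).integrable_comp hi).aestronglyMeasurable
    (.of_forall fun t x _ => ?_) ?_ (.of_forall fun t x _ => ?_)
  · by_cases ht : t ∈ Q '' K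
    · rw [Set.indicator_of_mem ht]
      exact (ContinuousLinearMap.opNorm_comp_le _ _).trans (by gcongr; exact hB _)
    · rw [Set.indicator_of_notMem ht, affine_eq_zero hQM hQN hf' x ht]
      simp
  · exact (integrable_indicator_iff hQK.measurableSet).2
      (integrableOn_const hQK.measure_lt_top.ne)
  · have h1 : HasFDerivAt f (fderiv ℝ f (M x + N t)) (M x + N t) :=
      (hc.differentiable one_ne_zero _).hasFDerivAt
    exact h1.comp x (M.hasFDerivAt.add_const _)

theorem fderiv_eq_zero_of_notMem {K : Set V} (hK : IsClosed K) {f : V → F}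
    (hf : ∀ x, x ∉ K → f x = 0) (x : V) (hx : x ∉ K) : fderiv ℝ f x = 0 := by
  by_contra h
  have : x ∈ tsupport f := support_fderiv_subset ℝ h
  exact hx (closure_minimal (fun z hz => by_contra fun h => Function.mem_support.1 hz (hf z h)) hK this)

theorem contDiff_affineIntegral (hQM : ∀ y, Q (M y) = 0) (hQN : ∀ t, Q (N t) = t) {K : Set V}
    (hK : IsCompact K) (j : ℕ) : ∀ {F : Type} [NormedAddCommGroup F] [NormedSpace ℝ F] [CompleteSpace F]
    {f : V → F}, ContDiff ℝ ∞ f → (∀ x, x ∉ K → f x = 0) →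
    ContDiff ℝ j (affineIntegral M N f) := by
  induction j with
  | zero =>
    intro F _ _ _ f hc hf
    have h := hasFDerivAt_affineIntegral hQM hQN hK (hc.of_le (by simp)) hf
      (fderiv_eq_zero_of_notMem hK.isClosed hf)
    exact contDiff_zero.2 (continuous_iff_continuousAt.2 fun y => (h y).continuousAt)
  | succ j ih =>
    intro F _ _ _ f hc hf
    have hf' := fderiv_eq_zero_of_notMem hK.isClosed hf
    have h := hasFDerivAt_affineIntegral hQM hQN hK (hc.of_le (by simp)) hf hf'
    push_cast
    refine contDiff_succ_iff_fderiv.2 ⟨fun y => (h y).differentiableAt, by simp, ?_⟩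
    have e : fderiv ℝ (affineIntegral M N f)
        = (ContinuousLinearMap.compL ℝ Y V F).flip M ∘ affineIntegral M N (fderiv ℝ f) :=
      funext fun y => (h y).fderiv
    rw [e]
    exact (ContinuousLinearMap.contDiff _).comp (ih (hc.fderiv_right (by simp)) hf')

theorem norm_iteratedFDeriv_affineIntegral_le (hQM : ∀ y, Q (M y) = 0)
    (hQN : ∀ t, Q (N t) = t) {K : Set V} (hK : IsCompact K) (j : ℕ) :
    ∀ {F : Type} [NormedAddCommGroup F] [NormedSpace ℝ F] [CompleteSpace F]
    {f : V → F} (_ : ContDiff ℝ ∞ f) (_ : ∀ x, x ∉ K → f x = 0) {B : ℝ}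
    (_ : ∀ x, ‖iteratedFDeriv ℝ j f x‖ ≤ B) (y : Y),
    ‖iteratedFDeriv ℝ j (affineIntegral M N f) y‖ ≤ ‖M‖ ^ j * (B * volume.real (Q '' K)) := by
  induction j with
  | zero =>
    intro F _ _ _ f hc hf B hB y
    simp only [norm_iteratedFDeriv_zero] at hB ⊢
    simpa using norm_affineIntegral_le hQM hQN hK hf hB y
  | succ j ih =>
    intro F _ _ _ f hc hf B hB y
    have hf' := fderiv_eq_zero_of_notMem hK.isClosed hf
    have h := hasFDerivAt_affineIntegral hQM hQN hK (hc.of_le (by simp)) hf hf'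
    have hc' : ContDiff ℝ ∞ (fderiv ℝ f) := hc.fderiv_right (by simp)
    have e : fderiv ℝ (affineIntegral M N f)
        = (ContinuousLinearMap.compL ℝ Y V F).flip M ∘ affineIntegral M N (fderiv ℝ f) :=
      funext fun y => (h y).fderiv
    simp only [← norm_iteratedFDeriv_fderiv] at hB ⊢
    rw [e, ContinuousLinearMap.iteratedFDeriv_comp_left _
      (contDiff_affineIntegral hQM hQN hK j hc' hf').contDiffAt le_rfl]
    refine (ContinuousLinearMap.norm_compContinuousMultilinearMap_le _ _).trans ?_
    have hM : ‖(ContinuousLinearMap.compL ℝ Y V F).flip M‖ ≤ ‖M‖ :=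
      ContinuousLinearMap.opNorm_le_bound _ (norm_nonneg _) fun A => by
        simpa [mul_comm] using ContinuousLinearMap.opNorm_comp_le A M
    rw [pow_succ', mul_assoc]
    exact mul_le_mul hM (ih hc' hf' hB y) (norm_nonneg _) (norm_nonneg _)

end AffineIntegral

/-- The Euclidean space `ℝⁿ`. -/
abbrev E (n : ℕ) : Type := EuclideanSpace ℝ (Fin n)

/-- Test functions: compactly supported smooth functions `ℝⁿ → F`, with the canonical LF
topology. -/
abbrev TestFn (n : ℕ) (F : Type) [NormedAddCommGroup F] [NormedSpace ℝ F] : Type :=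
  TestFunction (⊤ : Opens (E n)) F ⊤

/-- The space of distributions `𝒟'(ℝⁿ, F)`, for `F = ℂ` or `F = ℂᵏ`: continuous `ℂ`-linear
functionals on `F`-valued test functions, with the weak-* topology, that is, the topology of
pointwise convergence on test functions. -/
abbrev Distr (n : ℕ) (F : Type) [NormedAddCommGroup F] [NormedSpace ℂ F] : Type :=
  WeakDual ℂ (TestFn n F)

/-- The transpose `φ ↦ φ ∘ T` of a continuous linear map `T` between spaces of test functions. -/
def transposeMap {n m : ℕ} {F G : Type} [NormedAddCommGroup F] [NormedSpace ℂ F]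
    [NormedAddCommGroup G] [NormedSpace ℂ G] (T : TestFn n F →L[ℂ] TestFn m G) :
    Distr m G →ₗ[ℂ] Distr n F where
  toFun φ := StrongDual.toWeakDual ((WeakDual.toStrongDual φ).comp T)
  map_add' _ _ := rfl
  map_smul' _ _ := rfl

section Pullback

variable {n m : ℕ} (L : Matrix (Fin m) (Fin n) ℝ)

/-- The kernel `{x | L x = 0}` of the matrix `L`, as a subspace of Euclidean space. -/
abbrev kerSubspace : Submodule ℝ (E n) := LinearMap.ker (Matrix.toEuclideanLin L)

/-- The linear map `y ↦ Lᵀ (L Lᵀ)⁻¹ y`. -/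
def rightInv : E m →L[ℝ] E n :=
  (Matrix.toEuclideanLin (L.transpose * (L * L.transpose)⁻¹)).toContinuousLinearMap

/-- The isometric parametrisation `t ↦ ∑ i, t i • v i` of `ker L`, where `v` is an orthonormal
basis of `ker L`. -/
def kerParam : E (Module.finrank ℝ (kerSubspace L)) →L[ℝ] E n :=
  (kerSubspace L).subtypeL.comp
    (stdOrthonormalBasis ℝ (kerSubspace L)).repr.symm.toContinuousLinearEquiv.toContinuousLinearMap

/-- A continuous linear left inverse of `kerParam L` that vanishes on the range of
`rightInv L`. -/
def kerCoord : E n →L[ℝ] E (Module.finrank ℝ (kerSubspace L)) :=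
  ((stdOrthonormalBasis ℝ
      (kerSubspace L)).repr.toContinuousLinearEquiv.toContinuousLinearMap.comp
    (kerSubspace L).orthogonalProjectionOnto).comp
    (ContinuousLinearMap.id ℝ (E n) -
      (rightInv L).comp (Matrix.toEuclideanLin L).toContinuousLinearMap)

variable {L}

theorem toEuclideanLin_rightInv (h : (L * L.transpose).det ≠ 0) (y : E m) :
    Matrix.toEuclideanLin L (rightInv L y) = y := by
  ext i
  simp [rightInv, Matrix.toLpLin_apply, Matrix.mulVec_mulVec, ← Matrix.mul_assoc,
    Matrix.mul_nonsing_inv _ (isUnit_iff_ne_zero.2 h)]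

theorem toEuclideanLin_kerParam (t : E (Module.finrank ℝ (kerSubspace L))) :
    Matrix.toEuclideanLin L (kerParam L t) = 0 :=
  LinearMap.mem_ker.1 ((stdOrthonormalBasis ℝ (kerSubspace L)).repr.symm t).2

theorem kerCoord_rightInv (h : (L * L.transpose).det ≠ 0) (y : E m) :
    kerCoord L (rightInv L y) = 0 := by
  simp [kerCoord, toEuclideanLin_rightInv h]

theorem kerCoord_kerParam (t : E (Module.finrank ℝ (kerSubspace L))) :
    kerCoord L (kerParam L t) = t := by
  have h := toEuclideanLin_kerParam t
  simp [kerCoord, h]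
  simp [kerParam]

variable (L)

/-- The function `y ↦ det(L Lᵀ)^(-1/2) ∫ f (Lᵀ (L Lᵀ)⁻¹ y + ∑ i, t i • v i) dt` on `ℝᵐ`, where
`v` is an orthonormal basis of `ker L` and `t` runs over the coordinate space of `ker L`. -/
def fiberIntegral (f : E n → ℂ) (y : E m) : ℂ :=
  (√(L * L.transpose).det)⁻¹ • affineIntegral (rightInv L) (kerParam L) f y

variable {L}

theorem fiberIntegral_eq_zero (h : (L * L.transpose).det ≠ 0) {K : Set (E n)} {f : E n → ℂ}
    (hf : ∀ x, x ∉ K → f x = 0) {y : E m} (hy : y ∉ Matrix.toEuclideanLin L '' K) :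
    fiberIntegral L f y = 0 := by
  have : ∀ t, f (rightInv L y + kerParam L t) = 0 := fun t =>
    hf _ fun ht => hy ⟨_, ht, by
      rw [map_add, toEuclideanLin_rightInv h, toEuclideanLin_kerParam, add_zero]⟩
  simp [fiberIntegral, affineIntegral, this]

theorem contDiff_fiberIntegral (h : (L * L.transpose).det ≠ 0) {K : Set (E n)} (hK : IsCompact K)
    {f : E n → ℂ} (hc : ContDiff ℝ ∞ f) (hf : ∀ x, x ∉ K → f x = 0) :
    ContDiff ℝ ∞ (fiberIntegral L f) :=
  contDiff_infty.2 fun j => (contDiff_affineIntegral (kerCoord_rightInv h) kerCoord_kerParam hK j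
    hc hf).const_smul _

/-- Integration along the fibres of `L`, on smooth functions supported in a fixed compact set. -/
def fiberIntegralSupportedIn (h : (L * L.transpose).det ≠ 0) (K : Compacts (E n)) :
    ContDiffMapSupportedIn (E n) ℂ ⊤ K →L[ℂ] ContDiffMapSupportedIn (E m) ℂ ⊤
      (K.map (Matrix.toEuclideanLin L)
        (Matrix.toEuclideanLin L).toContinuousLinearMap.continuous) :=
  letI Φ : ContDiffMapSupportedIn (E n) ℂ ⊤ K →ₗ[ℂ] ContDiffMapSupportedIn (E m) ℂ ⊤
      (K.map (Matrix.toEuclideanLin L)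
        (Matrix.toEuclideanLin L).toContinuousLinearMap.continuous) :=
    { toFun f := ⟨fiberIntegral L f,
        contDiff_fiberIntegral h K.isCompact f.contDiff fun _ hx => f.zero_on_compl hx,
        fun _ hy => fiberIntegral_eq_zero h (fun _ hx => f.zero_on_compl hx) hy⟩
      map_add' f g := by
        ext y
        have hf := integrable_affine (kerCoord_rightInv h) kerCoord_kerParam K.isCompact
          f.continuous (fun x hx => f.zero_on_compl hx) y
        have hg := integrable_affine (kerCoord_rightInv h) kerCoord_kerParam K.isCompact
          g.continuous (fun x hx => g.zero_on_compl hx) y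
        change fiberIntegral L (fun x => f x + g x) y = fiberIntegral L f y + fiberIntegral L g y
        simp only [fiberIntegral, affineIntegral]
        rw [integral_add hf hg, smul_add]
      map_smul' c f := by
        ext y
        change fiberIntegral L (fun x => c • f x) y = c • fiberIntegral L f y
        simp only [fiberIntegral, affineIntegral]
        rw [integral_smul, smul_comm] }
  { toLinearMap := Φ
    cont := show Continuous Φ by
      refine WithSeminorms.continuous_of_isBounded (ContDiffMapSupportedIn.withSeminorms ℂ (E n) ℂ ⊤ K)
        (ContDiffMapSupportedIn.withSeminorms ℂ (E m) ℂ ⊤ _) _ (.of_real fun j => ?_)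
      refine ⟨{j}, |(√(L * L.transpose).det)⁻¹| * (‖rightInv L‖ ^ j *
        volume.real (kerCoord L '' K)), fun f => ?_⟩
      refine (ContDiffMapSupportedIn.seminorm_top_le_iff ℂ
        (mul_nonneg (by positivity) (apply_nonneg _ _)) j (Φ f)).2 fun y _ => ?_
      have hs : ∀ x, x ∉ (K : Set (E n)) → f x = 0 := fun x hx => f.zero_on_compl hx
      have hj := norm_iteratedFDeriv_affineIntegral_le (kerCoord_rightInv h) kerCoord_kerParam
        K.isCompact j f.contDiff hs
        (fun x => ContDiffMapSupportedIn.norm_iteratedFDeriv_apply_le_seminorm_top ℂ) y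
      have hd := contDiff_affineIntegral (kerCoord_rightInv h) kerCoord_kerParam
        K.isCompact j f.contDiff hs
      have e : iteratedFDeriv ℝ j (Φ f) y = (√(L * L.transpose).det)⁻¹ •
          iteratedFDeriv ℝ j (affineIntegral (rightInv L) (kerParam L) f) y :=
        iteratedFDeriv_const_smul_apply hd.contDiffAt
      rw [e, norm_smul, Real.norm_eq_abs, Finset.sup_singleton, mul_assoc]
      refine mul_le_mul_of_nonneg_left (hj.trans (le_of_eq (by ring))) (abs_nonneg _) }

variable (L)

/-- Integration along the fibres of `L`, `f ↦ fiberIntegral L f`, as a continuous linear map on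
test functions. It is defined for matrices of full row rank, and set to `0` otherwise. -/
def fiberIntegralCLM : TestFn n ℂ →L[ℂ] TestFn m ℂ :=
  open scoped Classical in
  if h : (L * L.transpose).det ≠ 0 then
    TestFunction.limitCLM ℂ
      (fun f =>
        ⟨fiberIntegral L f,
          contDiff_fiberIntegral h f.hasCompactSupport.isCompact f.contDiff
            fun _ hx => image_eq_zero_of_notMem_tsupport hx,
          HasCompactSupport.intro (f.hasCompactSupport.isCompact.image
              (Matrix.toEuclideanLin L).toContinuousLinearMap.continuous) fun _ hy =>
            fiberIntegral_eq_zero h (fun _ hx => image_eq_zero_of_notMem_tsupport hx) hy,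
          Set.subset_univ _⟩)
      (fun K _ => (TestFunction.ofSupportedInCLM ℂ (Set.subset_univ _)).comp
        (fiberIntegralSupportedIn h K))
      (fun _ _ _ => rfl)
  else 0

/-- The distribution `δ(L ·) = δ(L₁(x), …, Lₘ(x))` on `ℝⁿ`, for a distribution `δ` on `ℝᵐ` and a
matrix `L` of full row rank, whose rows are the coefficients of the linear forms `Lᵢ`. -/
def pullback (δ : Distr m ℂ) : Distr n ℂ :=
  transposeMap (fiberIntegralCLM L) δ

end Pullback

section Operators

variable {n : ℕ}

/-- The partial derivative `∂ᵢ` of scalar distributions, `(∂ᵢ φ)(f) = -φ(∂ᵢ f)`. -/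
def partialDeriv (i : Fin n) : Distr n ℂ →ₗ[ℂ] Distr n ℂ :=
  -transposeMap (TestFunction.lineDerivCLM ℂ (EuclideanSpace.single i (1 : ℝ)))

/-- The derivative `∂^α = ∂₁^α₁ ⋯ ∂ₙ^αₙ` of scalar distributions. -/
def multiDeriv (α : Fin n →₀ ℕ) : Module.End ℂ (Distr n ℂ) :=
  (List.ofFn fun i => (partialDeriv i : Module.End ℂ (Distr n ℂ)) ^ α i).prod

/-- The action of a polynomial `p ∈ ℂ[∂₁, …, ∂ₙ]` on scalar distributions. -/
def polyAction (p : MvPolynomial (Fin n) ℂ) (φ : Distr n ℂ) : Distr n ℂ :=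
  ∑ α ∈ p.support, p.coeff α • multiDeriv α φ

/-- The `j`-th component `f ↦ φ(f eⱼ)` of a `ℂᵏ`-valued distribution. -/
def component {k : ℕ} (φ : Distr n (Fin k → ℂ)) (j : Fin k) : Distr n ℂ :=
  transposeMap
    (TestFunction.postcompCLM (ContinuousLinearMap.single ℂ (fun _ : Fin k => ℂ) j)) φ

/-- The system of distributions `A • φ`, whose `i`-th entry is `∑ⱼ Aᵢⱼ • φⱼ`. -/
def applyOperator {l k : ℕ} (A : Matrix (Fin l) (Fin k) (MvPolynomial (Fin n) ℂ))
    (φ : Distr n (Fin k → ℂ)) : Fin l → Distr n ℂ :=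
  fun i => ∑ j, polyAction (A i j) (component φ j)

/-- `φ` is a solution to the system of partial differential equations `A • φ = 0`. -/
def IsSolution {l k : ℕ} (A : Matrix (Fin l) (Fin k) (MvPolynomial (Fin n) ℂ))
    (φ : Distr n (Fin k → ℂ)) : Prop :=
  applyOperator A φ = 0

/-- The matrix `A(ξ)`, for a real vector `ξ`. -/
def evalAt {l k : ℕ} (A : Matrix (Fin l) (Fin k) (MvPolynomial (Fin n) ℂ)) (ξ : E n) :
    Matrix (Fin l) (Fin k) ℂ :=
  A.map (MvPolynomial.eval fun i => (ξ i : ℂ))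

/-- `(u, π)` is a wave pair for `A`: one has `A(ξ) u = 0` for all `ξ ∈ π`. -/
def IsWavePair {l k : ℕ} (A : Matrix (Fin l) (Fin k) (MvPolynomial (Fin n) ℂ))
    (u : Fin k → ℂ) (π : Submodule ℝ (E n)) : Prop :=
  ∀ ξ ∈ π, (evalAt A ξ).mulVec u = 0

end Operators

section Waves

variable {n k : ℕ}

/-- The bilinear pairing `(v, w) ↦ ∑ⱼ vⱼ wⱼ` on `ℂᵏ`. -/
def dotCLM (k : ℕ) : (Fin k → ℂ) →L[ℂ] (Fin k → ℂ) →L[ℂ] ℂ :=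
  ∑ j, (ContinuousLinearMap.mul ℂ ℂ).bilinearComp
    (ContinuousLinearMap.proj j) (ContinuousLinearMap.proj j)

/-- The distribution `f ↦ ∫ f · φ` given by a locally integrable function `φ : ℝⁿ → ℂᵏ`. -/
def ofFunction (φ : E n → Fin k → ℂ) : Distr n (Fin k → ℂ) :=
  StrongDual.toWeakDual (TestFunction.integralAgainstBilinCLM (dotCLM k) volume φ)

/-- The simple wave `x ↦ exp(i ξ · x) u`. -/
def simpleWave (ξ : E n) (u : Fin k → ℂ) (x : E n) : Fin k → ℂ :=
  Complex.exp (Complex.I * ((∑ i, ξ i * x i : ℝ) : ℂ)) • u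

/-- The classical wave solutions for `(u, π)`: finite superpositions of simple waves with
amplitude `u` and frequencies in `π`. -/
def classicalWaves (u : Fin k → ℂ) (π : Submodule ℝ (E n)) : Set (Distr n (Fin k → ℂ)) :=
  {φ | ∃ (p : ℕ) (c : Fin p → ℂ) (ξ : Fin p → E n), (∀ j, ξ j ∈ π) ∧
    φ = ofFunction fun x => ∑ j, c j • simpleWave (ξ j) u x}

/-- The wave solutions for `(u, π)`: the closure of the classical wave solutions in the space of
distributions. -/
def waveSolutions (u : Fin k → ℂ) (π : Submodule ℝ (E n)) : Set (Distr n (Fin k → ℂ)) :=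
  closure (classicalWaves u π)

/-- The `ℂᵏ`-valued distribution `S · u`, `f ↦ S(∑ⱼ uⱼ fⱼ)`, for a scalar distribution `S`. -/
def tensorVec (S : Distr n ℂ) (u : Fin k → ℂ) : Distr n (Fin k → ℂ) :=
  transposeMap (TestFunction.postcompCLM (dotCLM k u)) S

end Waves

end
end WavePairs

namespace WavePairs

noncomputable section

open MeasureTheory TopologicalSpace
open scoped ContDiff FourierTransform

/-! Everything reduces to plane waves. A test function orthogonal to all plane waves has zero
Fourier transform, hence vanishes; since the dual of the weak-* topology consists of evaluations at
test functions, plane waves span a dense subspace of the scalar distributions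
(`dense_span_planeWaveDistr`).

The wave with frequency `η` pulls back along `L` to a nonzero multiple of the wave with frequency
`Lᵀ η` (`exists_pullback_planeWaveDistr`), and these frequencies fill `(ker L)ᗮ = π`
(`mem_iff_exists_transpose`). So the weak-* continuous map `δ ↦ δ(L ·) u` carries the span of all
plane waves onto the classical waves. By density its range lies in their closure. Equality holds
because the range is closed (`isClosed_range_waveMap`): for `u ≠ 0` the map has a continuous left
inverse, the transpose of a continuous section of fibre integration.

For the second claim, `A` sends `exp(i ξ · x) u` to `i ^ d A(ξ) u exp(i ξ · x)` by homogeneity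
(`applyOperator_planeWaveDistr`). A wave pair thus annihilates a dense set of `δ`, hence all by
continuity; conversely, testing on single plane waves recovers `A(ξ) u = 0`. -/

/-! ### Weak-* continuity and density. -/

theorem continuous_transposeMap {n m : ℕ} {F G : Type} [NormedAddCommGroup F] [NormedSpace ℂ F]
    [NormedAddCommGroup G] [NormedSpace ℂ G] (T : TestFn n F →L[ℂ] TestFn m G) :
    Continuous (transposeMap T) :=
  WeakDual.continuous_of_continuous_eval fun f => WeakDual.eval_continuous (T f)

/-- A subspace of the weak dual that separates points is weak-* dense. -/
theorem dense_of_separating {n : ℕ} {F : Type} [NormedAddCommGroup F] [NormedSpace ℂ F]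
    (V : Submodule ℂ (Distr n F)) (hV : ∀ f : TestFn n F, (∀ φ ∈ V, φ f = 0) → f = 0) :
    Dense (V : Set (Distr n F)) := by
  classical
  intro δ
  have interpolate : ∀ s : Finset (TestFn n F), ∃ φ ∈ V, ∀ f ∈ s, φ f = δ f := by
    intro s
    let ev : Distr n F →ₗ[ℂ] (s → ℂ) :=
      { toFun := fun φ f => φ f
        map_add' := fun _ _ => rfl
        map_smul' := fun _ _ => rfl }
    by_contra hne
    have hnot : ev δ ∉ V.map ev := by
      rintro ⟨φ, hφ, he⟩
      exact hne ⟨φ, hφ, fun f hf => congrFun he ⟨f, hf⟩⟩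
    -- Finite-dimensional Hahn–Banach: `g` kills the values taken by `V` on `s` but not those of
    -- `δ`. As a functional of finitely many values, `g` is evaluation at one combination of the
    -- test functions in `s`, which separation forces to be zero.
    obtain ⟨g, hg, hgV⟩ := Submodule.exists_le_ker_of_notMem hnot
    have key : ∀ φ : Distr n F, g (ev φ) = φ (∑ f : s, g (Pi.single f 1) • (f : TestFn n F)) := by
      intro φ
      rw [map_sum, LinearMap.pi_apply_eq_sum_univ g (ev φ)]
      refine Finset.sum_congr rfl fun f _ => ?_
      rw [map_smul, smul_eq_mul, smul_eq_mul, mul_comm]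
      congr 2
      ext j
      simp [Pi.single_apply, eq_comm]
    have hz := hV (∑ f : s, g (Pi.single f 1) • (f : TestFn n F)) fun φ hφ => by
      rw [← key]
      exact hgV ⟨φ, hφ, rfl⟩
    exact hg (by rw [key, hz, map_zero])
  choose φ hφV hφ using interpolate
  -- The net of interpolants, indexed by finite sets, is eventually equal to `δ` at each test
  -- function.
  refine mem_closure_of_tendsto (b := Filter.atTop) (f := φ) ?_ (.of_forall hφV)
  refine tendsto_iff_forall_eval_tendsto_topDualPairing.2 fun f => ?_
  refine tendsto_const_nhds.congr' ?_
  filter_upwards [Filter.eventually_ge_atTop {f}] with s hs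
  exact (hφ s f (hs (Finset.mem_singleton_self f))).symm

/-! ### Plane waves and Fourier uniqueness. -/

/-- The plane wave `x ↦ exp(i ξ · x)`. -/
def planeWave {n : ℕ} (ξ x : E n) : ℂ :=
  Complex.exp (Complex.I * ((∑ i, ξ i * x i : ℝ) : ℂ))

section PlaneWaves

variable {n : ℕ}

theorem planeWave_eq_inner (ξ x : E n) :
    planeWave ξ x = Complex.exp (Complex.I * (innerSL ℝ ξ x : ℂ)) := by
  simp [planeWave, PiLp.inner_apply, mul_comm]

theorem hasFDerivAt_planeWave (ξ x : E n) :
    HasFDerivAt (planeWave ξ)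
      (planeWave ξ x • Complex.I • Complex.ofRealCLM.comp (innerSL ℝ ξ)) x := by
  have h : HasFDerivAt (fun x => Complex.I * (innerSL ℝ ξ x : ℂ))
      (Complex.I • Complex.ofRealCLM.comp (innerSL ℝ ξ)) x :=
    ((Complex.ofRealCLM.comp (innerSL ℝ ξ)).hasFDerivAt (x := x)).const_mul Complex.I
  rw [planeWave_eq_inner]
  exact h.cexp.congr_of_eventuallyEq (.of_forall fun x => planeWave_eq_inner ξ x)

theorem fderiv_planeWave_single (ξ x : E n) (i : Fin n) :
    fderiv ℝ (planeWave ξ) x (EuclideanSpace.single i 1)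
      = Complex.I * ξ i * planeWave ξ x := by
  rw [(hasFDerivAt_planeWave ξ x).fderiv]
  simp [EuclideanSpace.inner_single_right]
  ring

theorem differentiable_planeWave (ξ : E n) : Differentiable ℝ (planeWave ξ) :=
  fun x => (hasFDerivAt_planeWave ξ x).differentiableAt

theorem continuous_planeWave (ξ : E n) : Continuous (planeWave ξ) :=
  (differentiable_planeWave ξ).continuous

/-- The distribution given by the plane wave `x ↦ exp(i ξ · x)`. -/
def planeWaveDistr (ξ : E n) : Distr n ℂ :=
  StrongDual.toWeakDual
    (TestFunction.integralAgainstBilinCLM (ContinuousLinearMap.mul ℂ ℂ) volume (planeWave ξ))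

theorem planeWaveDistr_apply (ξ : E n) (f : TestFn n ℂ) :
    planeWaveDistr ξ f = ∫ x, f x * planeWave ξ x :=
  TestFunction.integralAgainstBilinCLM_eq_integral
    ((continuous_planeWave ξ).locallyIntegrable.locallyIntegrableOn _)

theorem integrable_mul_of_continuous (f : TestFn n ℂ) {g : E n → ℂ} (hg : Continuous g) :
    Integrable fun x => f x * g x :=
  (f.continuous.mul hg).integrable_of_hasCompactSupport f.hasCompactSupport.mul_right

/-- A test function whose pairings with all plane waves vanish is zero. -/
theorem eq_zero_of_planeWaveDistr_eq_zero (f : TestFn n ℂ)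
    (h : ∀ ξ : E n, planeWaveDistr ξ f = 0) : f = 0 := by
  have hF : 𝓕 (f : E n → ℂ) = 0 := by
    ext w
    -- The Fourier kernel is `exp(-2πi ⟨x, w⟩)`, a plane wave of frequency `-2π w`.
    rw [Real.fourier_eq', Pi.zero_apply, ← h (-(2 * Real.pi) • w), planeWaveDistr_apply]
    refine integral_congr_ae (.of_forall fun x => ?_)
    simp only [planeWave_eq_inner, smul_eq_mul]
    rw [mul_comm]
    congr 2
    rw [innerSL_apply_apply, inner_smul_left, real_inner_comm]
    push_cast
    simp
    ring
  have hf : Integrable (f : E n → ℂ) :=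
    f.continuous.integrable_of_hasCompactSupport f.hasCompactSupport
  have hinv := f.continuous.fourierInv_fourier_eq hf (by rw [hF]; exact integrable_zero _ _ _)
  ext x
  rw [← hinv, hF, Real.fourierInv_eq']
  simp

theorem dense_span_planeWaveDistr :
    Dense (Submodule.span ℂ (Set.range (planeWaveDistr (n := n))) : Set (Distr n ℂ)) :=
  dense_of_separating _ fun f h => eq_zero_of_planeWaveDistr_eq_zero f fun ξ =>
    h _ (Submodule.subset_span ⟨ξ, rfl⟩)

/-- Testing against real smooth functions would make the wave vanish almost everywhere, but an
exponential has no zeros. This lets a scalar be read off from a multiple of a plane wave. -/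
theorem planeWaveDistr_ne_zero (ξ : E n) : planeWaveDistr ξ ≠ 0 := by
  intro h
  have h0 : ∀ᵐ x, planeWave ξ x = 0 := by
    refine ae_eq_zero_of_integral_contDiff_smul_eq_zero
      (continuous_planeWave ξ).locallyIntegrable fun g hg hs => ?_
    have := DFunLike.congr_fun h (⟨fun x => (g x : ℂ), Complex.ofRealCLM.contDiff.comp hg,
      hs.comp_left (g := Complex.ofReal) (by simp), Set.subset_univ _⟩ : TestFn n ℂ)
    rw [planeWaveDistr_apply] at this
    refine (integral_congr_ae (.of_forall fun x => ?_)).trans this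
    exact Complex.real_smul
  obtain ⟨x, hx⟩ := h0.exists
  exact Complex.exp_ne_zero _ hx

/-! ### Constant-coefficient operators on plane waves. -/

theorem partialDeriv_planeWaveDistr (i : Fin n) (ξ : E n) :
    partialDeriv i (planeWaveDistr ξ) = (Complex.I * ξ i) • planeWaveDistr ξ := by
  refine DFunLike.ext _ _ fun f => ?_
  have hf : ∀ x, lineDeriv ℝ f x (EuclideanSpace.single i 1)
      = fderiv ℝ f x (EuclideanSpace.single i 1) := fun x =>
    (f.contDiff.differentiable (by simp) x).lineDeriv_eq_fderiv
  change -(planeWaveDistr ξ _) = (Complex.I * ξ i) * planeWaveDistr ξ f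
  rw [planeWaveDistr_apply, planeWaveDistr_apply]
  have hd : ∀ x, (TestFunction.lineDerivCLM ℂ (EuclideanSpace.single i (1 : ℝ)) f : TestFn n ℂ) x
      = fderiv ℝ f x (EuclideanSpace.single i 1) := fun x =>
    (TestFunction.lineDerivCLM_apply_of_le (by simp)).trans (hf x)
  have e : ∫ x, (TestFunction.lineDerivCLM ℂ (EuclideanSpace.single i (1 : ℝ)) f : TestFn n ℂ) x
      * planeWave ξ x = ∫ x, fderiv ℝ f x (EuclideanSpace.single i 1) * planeWave ξ x := by
    simp only [hd]
  refine (congrArg Neg.neg e).trans ?_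
  have hdc : Continuous fun x => fderiv ℝ f x (EuclideanSpace.single i 1) :=
    (f.contDiff.continuous_fderiv (by simp)).clm_apply continuous_const
  rw [← integral_mul_fderiv_eq_neg_fderiv_mul_of_integrable, ← integral_const_mul]
  · refine integral_congr_ae (.of_forall fun x => ?_)
    simp only [fderiv_planeWave_single]
    ring
  · exact (hdc.mul (continuous_planeWave ξ)).integrable_of_hasCompactSupport
      (f.hasCompactSupport.fderiv_apply ℝ _).mul_right
  · simp only [fderiv_planeWave_single]
    exact integrable_mul_of_continuous f ((continuous_planeWave ξ).const_mul _)
  · exact integrable_mul_of_continuous f (continuous_planeWave ξ)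
  · exact fun x _ => f.contDiff.differentiable (by simp) x
  · exact fun x _ => differentiable_planeWave ξ x

/-- A common eigenvector makes the order of the factors irrelevant, so partial derivatives need not
be shown to commute. -/
theorem list_prod_apply_of_eigen {V : Type} [AddCommGroup V] [Module ℂ V] {ι : Type} (v : V)
    (T : ι → Module.End ℂ V) (c : ι → ℂ) (h : ∀ i, T i v = c i • v) (l : List ι) :
    (l.map T).prod v = (l.map c).prod • v := by
  induction l with
  | nil => simp
  | cons i l ih => simp [ih, h, smul_smul, mul_comm]

theorem multiDeriv_planeWaveDistr (α : Fin n →₀ ℕ) (ξ : E n) :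
    multiDeriv α (planeWaveDistr ξ) = (∏ i, (Complex.I * ξ i) ^ α i) • planeWaveDistr ξ := by
  have hpow : ∀ i (j : ℕ), ((partialDeriv i : Module.End ℂ (Distr n ℂ)) ^ j) (planeWaveDistr ξ)
      = (Complex.I * ξ i) ^ j • planeWaveDistr ξ := by
    intro i j
    induction j with
    | zero => simp
    | succ j ih => rw [pow_succ', Module.End.mul_apply, ih, map_smul,
        partialDeriv_planeWaveDistr, smul_smul, pow_succ]
  rw [multiDeriv, List.ofFn_eq_map, list_prod_apply_of_eigen _ _ _ fun i => hpow i (α i),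
    ← List.ofFn_eq_map, List.prod_ofFn]

theorem polyAction_planeWaveDistr (p : MvPolynomial (Fin n) ℂ) (ξ : E n) :
    polyAction p (planeWaveDistr ξ)
      = MvPolynomial.eval (fun i => Complex.I * ξ i) p • planeWaveDistr ξ := by
  rw [polyAction, MvPolynomial.eval_eq', Finset.sum_smul]
  simp only [multiDeriv_planeWaveDistr, smul_smul]

theorem continuous_partialDeriv (i : Fin n) :
    Continuous (partialDeriv i : Distr n ℂ → Distr n ℂ) :=
  (continuous_transposeMap _).neg

theorem continuous_multiDeriv (α : Fin n →₀ ℕ) :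
    Continuous (multiDeriv α : Distr n ℂ → Distr n ℂ) := by
  have hpow : ∀ i (j : ℕ), Continuous ((partialDeriv i : Module.End ℂ (Distr n ℂ)) ^ j) := by
    intro i j
    induction j with
    | zero => exact continuous_id
    | succ j ih =>
      rw [pow_succ']
      exact (continuous_partialDeriv i).comp ih
  rw [multiDeriv, List.ofFn_eq_map]
  induction List.finRange n with
  | nil => exact continuous_id
  | cons i l ih =>
    rw [List.map_cons, List.prod_cons]
    exact (hpow i _).comp ih

theorem continuous_polyAction (p : MvPolynomial (Fin n) ℂ) :
    Continuous (polyAction p) :=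
  continuous_finsetSum _ fun α _ =>
    (continuous_const_smul (p.coeff α)).comp (continuous_multiDeriv α)

theorem polyAction_add (p : MvPolynomial (Fin n) ℂ) (φ ψ : Distr n ℂ) :
    polyAction p (φ + ψ) = polyAction p φ + polyAction p ψ := by
  simp [polyAction, Finset.sum_add_distrib]

theorem polyAction_smul (p : MvPolynomial (Fin n) ℂ) (c : ℂ) (φ : Distr n ℂ) :
    polyAction p (c • φ) = c • polyAction p φ := by
  simp [polyAction, Finset.smul_sum, smul_comm c]

/-! ### Vector amplitudes and the symbol of `A`. -/

section Vector

variable {k l : ℕ}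

theorem dotCLM_apply (u v : Fin k → ℂ) : dotCLM k u v = ∑ j, u j * v j := by
  simp [dotCLM]

theorem continuous_simpleWave (ξ : E n) (u : Fin k → ℂ) : Continuous (simpleWave ξ u) :=
  (continuous_planeWave ξ).smul continuous_const

theorem ofFunction_apply {φ : E n → Fin k → ℂ} (hφ : Continuous φ) (f : TestFn n (Fin k → ℂ)) :
    ofFunction φ f = ∫ x, dotCLM k (f x) (φ x) :=
  TestFunction.integralAgainstBilinCLM_eq_integral (hφ.locallyIntegrable.locallyIntegrableOn _)

/-- Moves superpositions from functions to distributions, where the remaining argument is linear. -/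
theorem ofFunction_sum_simpleWave (u : Fin k → ℂ) {p : ℕ} (c : Fin p → ℂ) (ξ : Fin p → E n) :
    ofFunction (fun x => ∑ j, c j • simpleWave (ξ j) u x)
      = tensorVec (∑ j, c j • planeWaveDistr (ξ j)) u := by
  refine DFunLike.ext _ _ fun f => ?_
  have hc : Continuous fun x => ∑ j, c j • simpleWave (ξ j) u x :=
    continuous_finsetSum _ fun j _ =>
      (continuous_const_smul (c j)).comp (continuous_simpleWave (ξ j) u)
  rw [ofFunction_apply hc]
  let g : TestFn n ℂ := TestFunction.postcompCLM (dotCLM k u) f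
  have hg : ∀ x, g x = dotCLM k (f x) u := fun x => by
    change dotCLM k u (f x) = _
    simp [dotCLM_apply, mul_comm]
  have e : tensorVec (∑ j, c j • planeWaveDistr (ξ j)) u f
      = ∑ j, c j * ∫ x, g x * planeWave (ξ j) x := by
    change (∑ j, c j • planeWaveDistr (ξ j)) g = _
    simp_rw [← planeWaveDistr_apply]
    let ev : Distr n ℂ →ₗ[ℂ] ℂ :=
      { toFun := fun φ => φ g
        map_add' := fun _ _ => rfl
        map_smul' := fun _ _ => rfl }
    exact (map_sum ev _ _).trans (Finset.sum_congr rfl fun j _ => map_smul ev _ _)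
  rw [e]
  simp_rw [← integral_const_mul]
  rw [← integral_finsetSum _ fun j _ =>
    (integrable_mul_of_continuous g (continuous_planeWave (ξ j))).const_mul _]
  refine integral_congr_ae (.of_forall fun x => ?_)
  simp only [map_sum, map_smul, hg, simpleWave, planeWave, smul_eq_mul]
  exact Finset.sum_congr rfl fun j _ => by ring

theorem component_tensorVec (S : Distr n ℂ) (u : Fin k → ℂ) (j : Fin k) :
    component (tensorVec S u) j = u j • S := by
  refine DFunLike.ext _ _ fun f => ?_
  change S _ = u j * S f
  rw [← smul_eq_mul, ← map_smul]
  congr 1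
  ext x
  change dotCLM k u (Pi.single j (f x)) = u j * f x
  simp [dotCLM_apply, Pi.single_apply]

theorem applyOperator_tensorVec (A : Matrix (Fin l) (Fin k) (MvPolynomial (Fin n) ℂ))
    (S : Distr n ℂ) (u : Fin k → ℂ) (i : Fin l) :
    applyOperator A (tensorVec S u) i = ∑ j, u j • polyAction (A i j) S := by
  simp only [applyOperator, component_tensorVec, polyAction_smul]

theorem _root_.MvPolynomial.IsHomogeneous.eval_smul_eq {σ R : Type} [CommSemiring R] [Fintype σ]
    {p : MvPolynomial σ R} {d : ℕ} (hp : p.IsHomogeneous d) (c : R) (x : σ → R) :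
    MvPolynomial.eval (c • x) p = c ^ d * MvPolynomial.eval x p := by
  rw [MvPolynomial.eval_eq', MvPolynomial.eval_eq', Finset.mul_sum]
  refine Finset.sum_congr rfl fun α hα => ?_
  have hd : ∑ i, α i = d := by
    have := hp (MvPolynomial.mem_support_iff.1 hα)
    rw [← Finsupp.degree_eq_sum, Finsupp.degree_eq_weight_one]
    exact this
  simp only [Pi.smul_apply, smul_eq_mul, mul_pow, Finset.prod_mul_distrib,
    Finset.prod_pow_eq_pow_sum, hd]
  ring

/-- Derivatives evaluate the symbol at `i ξ`. Since all entries have the same degree, a single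
nonzero factor `I ^ d` comes out and leaves `A(ξ) u`. -/
theorem applyOperator_planeWaveDistr {d : ℕ}
    {A : Matrix (Fin l) (Fin k) (MvPolynomial (Fin n) ℂ)} (hA : ∀ i j, (A i j).IsHomogeneous d)
    (ξ : E n) (u : Fin k → ℂ) (i : Fin l) :
    applyOperator A (tensorVec (planeWaveDistr ξ) u) i
      = (Complex.I ^ d * (evalAt A ξ).mulVec u i) • planeWaveDistr ξ := by
  rw [applyOperator_tensorVec]
  simp only [polyAction_planeWaveDistr, smul_smul, ← Finset.sum_smul]
  congr 1
  rw [Matrix.mulVec, dotProduct, Finset.mul_sum]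
  refine Finset.sum_congr rfl fun j _ => ?_
  have : (fun i => Complex.I * (ξ i : ℂ)) = Complex.I • fun i => (ξ i : ℂ) := rfl
  rw [this, (hA i j).eval_smul_eq]
  simp only [evalAt, Matrix.map_apply]
  ring

end Vector

end PlaneWaves

/-! ### Composition with a linear map followed by multiplication by a cutoff. -/

section MulComp

variable {n m : ℕ} {h : E n → ℂ} {Λ : E n →L[ℝ] E m}

theorem mul_comp_eq_zero {K : Compacts (E m)} {K' : Compacts (E n)}
    (hK : ∀ x, x ∉ K' → Λ x ∈ K → h x = 0) {f : E m → ℂ} (hf : ∀ y, y ∉ K → f y = 0) {x : E n}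
    (hx : x ∉ K') : h x * f (Λ x) = 0 := by
  by_cases hxK : Λ x ∈ K
  · rw [hK x hx hxK, zero_mul]
  · rw [hf _ hxK, mul_zero]

/-- Leibniz rule and chain rule. The derivatives of `h` are bounded only on the compact `K'`, which
suffices because the product is supported there. -/
theorem exists_norm_iteratedFDeriv_mul_comp_le (hh : ContDiff ℝ ∞ h) (K : Compacts (E m))
    (K' : Compacts (E n)) (j : ℕ) :
    ∃ C : ℝ, 0 ≤ C ∧ ∀ f : ContDiffMapSupportedIn (E m) ℂ ⊤ K, ∀ x ∈ K',
      ‖iteratedFDeriv ℝ j (fun x => h x * f (Λ x)) x‖ ≤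
        C * ((Finset.Iic j).sup fun i => ContDiffMapSupportedIn.seminorm ℂ (E m) ℂ ⊤ K i) f := by
  have hB : ∀ i : ℕ, ∃ B : ℝ, ∀ x ∈ K', ‖iteratedFDeriv ℝ i h x‖ ≤ B := fun i =>
    K'.isCompact.exists_bound_of_continuousOn
      (hh.continuous_iteratedFDeriv (by exact_mod_cast le_top)).continuousOn
  choose B hB using hB
  refine ⟨∑ i ∈ Finset.range (j + 1), (j.choose i : ℝ) * |B i| * ‖Λ‖ ^ (j - i),
    by positivity, fun f x hx => ?_⟩
  have hfc : ContDiff ℝ ∞ f := f.contDiff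
  have hj : (j : WithTop ℕ∞) ≤ ∞ := by exact_mod_cast le_top
  refine (norm_iteratedFDeriv_mul_le hh (hfc.comp Λ.contDiff) x hj).trans ?_
  rw [Finset.sum_mul]
  refine Finset.sum_le_sum fun i _ => ?_
  have h1 : ‖iteratedFDeriv ℝ (j - i) (f ∘ Λ) x‖ ≤ ‖Λ‖ ^ (j - i) *
      ((Finset.Iic j).sup fun i => ContDiffMapSupportedIn.seminorm ℂ (E m) ℂ ⊤ K i) f := by
    rw [Λ.iteratedFDeriv_comp_right hfc x (i := j - i)
      (WithTop.coe_le_coe.2 le_top)]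
    refine (ContinuousMultilinearMap.norm_compContinuousLinearMap_le _ _).trans ?_
    rw [Finset.prod_const, Finset.card_univ, Fintype.card_fin, mul_comm]
    gcongr
    exact (ContDiffMapSupportedIn.norm_iteratedFDeriv_apply_le_seminorm_top ℂ).trans
      (Seminorm.le_finset_sup_apply (Finset.mem_Iic.2 (Nat.sub_le j i)))
  rw [mul_assoc _ (‖Λ‖ ^ (j - i))]
  gcongr
  exact (hB i x hx).trans (le_abs_self _)

/-- The map `f ↦ (x ↦ h x * f (Λ x))`, on smooth functions supported in a fixed compact set. -/
def mulCompSupportedIn (hh : ContDiff ℝ ∞ h) (K : Compacts (E m)) (K' : Compacts (E n))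
    (hK : ∀ x, x ∉ K' → Λ x ∈ K → h x = 0) :
    ContDiffMapSupportedIn (E m) ℂ ⊤ K →L[ℂ] ContDiffMapSupportedIn (E n) ℂ ⊤ K' :=
  letI Φ : ContDiffMapSupportedIn (E m) ℂ ⊤ K →ₗ[ℂ] ContDiffMapSupportedIn (E n) ℂ ⊤ K' :=
    { toFun f := ⟨fun x => h x * f (Λ x), hh.mul (f.contDiff.comp Λ.contDiff),
        fun x hx => mul_comp_eq_zero hK (fun _ hy => f.zero_on_compl hy) hx⟩
      map_add' f g := ContDiffMapSupportedIn.ext fun x => mul_add _ _ _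
      map_smul' c f := ContDiffMapSupportedIn.ext fun x => mul_left_comm _ _ _ }
  { toLinearMap := Φ
    cont := show Continuous Φ by
      refine WithSeminorms.continuous_of_isBounded
        (ContDiffMapSupportedIn.withSeminorms ℂ (E m) ℂ ⊤ K)
        (ContDiffMapSupportedIn.withSeminorms ℂ (E n) ℂ ⊤ K') _ (.of_real fun j => ?_)
      obtain ⟨C, hC, hb⟩ := exists_norm_iteratedFDeriv_mul_comp_le (Λ := Λ) hh K K' j
      exact ⟨_, C, fun f => (ContDiffMapSupportedIn.seminorm_top_le_iff ℂ
        (mul_nonneg hC (apply_nonneg _ _)) j (Φ f)).2 (hb f)⟩ }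

/-- The map `f ↦ (x ↦ h x * f (Λ x))` on test functions, for a smooth function `h` on whose
support `Λ` is proper. -/
def mulCompCLM (hh : ContDiff ℝ ∞ h)
    (hK : ∀ K : Compacts (E m), ∃ K' : Compacts (E n), ∀ x, x ∉ K' → Λ x ∈ K → h x = 0) :
    TestFn m ℂ →L[ℂ] TestFn n ℂ :=
  TestFunction.limitCLM ℂ
    (fun f => ⟨fun x => h x * f (Λ x), hh.mul (f.contDiff.comp Λ.contDiff),
      HasCompactSupport.intro (hK ⟨_, f.hasCompactSupport⟩).choose.isCompact fun _ hx =>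
        mul_comp_eq_zero (hK ⟨_, f.hasCompactSupport⟩).choose_spec
          (fun _ hy => image_eq_zero_of_notMem_tsupport hy) hx,
      Set.subset_univ _⟩)
    (fun K _ => (TestFunction.ofSupportedInCLM ℂ (Set.subset_univ _)).comp
      (mulCompSupportedIn hh K (hK K).choose (hK K).choose_spec))
    (fun _ _ _ => rfl)

theorem mulCompCLM_apply (hh : ContDiff ℝ ∞ h)
    (hK : ∀ K : Compacts (E m), ∃ K' : Compacts (E n), ∀ x, x ∉ K' → Λ x ∈ K → h x = 0)
    (f : TestFn m ℂ) (x : E n) : mulCompCLM hh hK f x = h x * f (Λ x) :=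
  rfl

end MulComp

/-! ### Fibre integration: section, change of variables, pullback of plane waves. -/

section Fiber

variable {n m : ℕ} {L : Matrix (Fin m) (Fin n) ℝ}


theorem sqrt_det_ne_zero (h : (L * L.transpose).det ≠ 0) : √(L * L.transpose).det ≠ 0 := by
  refine (Real.sqrt_pos.2 (lt_of_le_of_ne ?_ h.symm)).ne'
  have := (Matrix.posSemidef_self_mul_conjTranspose L).det_nonneg
  simpa [Matrix.conjTranspose_eq_transpose_of_trivial] using this

/-- Subtracting `rightInv L (L x)` from `x` lands in `ker L`, where the orthogonal projection is the
identity. -/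
theorem rightInv_add_kerParam (h : (L * L.transpose).det ≠ 0) (x : E n) :
    rightInv L (Matrix.toEuclideanLin L x) + kerParam L (kerCoord L x) = x := by
  have hker : x - rightInv L (Matrix.toEuclideanLin L x) ∈ kerSubspace L := by
    rw [LinearMap.mem_ker, map_sub, toEuclideanLin_rightInv h, sub_self]
  have : kerParam L (kerCoord L x) = x - rightInv L (Matrix.toEuclideanLin L x) := by
    simpa [kerParam, kerCoord] using Submodule.starProjection_eq_self_iff.2 hker
  rw [this, add_sub_cancel]

theorem fiberIntegralCLM_apply (h : (L * L.transpose).det ≠ 0) (f : TestFn n ℂ) (y : E m) :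
    fiberIntegralCLM L f y = fiberIntegral L f y := by
  rw [fiberIntegralCLM, dif_pos h]
  rfl

/-- Integration along the fibres of `L` has a continuous linear right inverse. -/
theorem exists_rightInverse_fiberIntegralCLM (h : (L * L.transpose).det ≠ 0) :
    ∃ S : TestFn m ℂ →L[ℂ] TestFn n ℂ, ∀ g, fiberIntegralCLM L (S g) = g := by
  let b : ContDiffBump (0 : E (Module.finrank ℝ (kerSubspace L))) := default
  let c : ℝ := √(L * L.transpose).det
  -- The section is `g ↦ χ(kerCoord x) g(L x)`; the total mass `c` of `χ` cancels the factor `det(L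
  -- Lᵀ)^(-1/2)` in the fibre integral.
  let χ : E (Module.finrank ℝ (kerSubspace L)) → ℂ := fun t => ((c * b.normed volume t : ℝ) : ℂ)
  have hc : c ≠ 0 := (sqrt_det_ne_zero h)
  have hχ : ContDiff ℝ ∞ χ :=
    Complex.ofRealCLM.contDiff.comp (contDiff_const.mul b.contDiff_normed)
  have hint : ∫ t, χ t = c := by
    rw [integral_complex_ofReal, integral_const_mul, b.integral_normed, mul_one]
  have hK : ∀ K : Compacts (E m), ∃ K' : Compacts (E n), ∀ x, x ∉ K' →
      (Matrix.toEuclideanLin L).toContinuousLinearMap x ∈ K → (χ ∘ kerCoord L) x = 0 := by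
    intro K
    -- In the coordinates `(L x, kerCoord L x)` the support lies in a product of compact sets.
    refine ⟨⟨(fun p : E m × E _ => rightInv L p.1 + kerParam L p.2) ''
      ((K : Set (E m)) ×ˢ tsupport (b.normed volume)),
      (K.isCompact.prod b.hasCompactSupport_normed).image (by fun_prop)⟩, fun x hx hxK => ?_⟩
    by_contra hne
    refine hx ⟨(_, kerCoord L x), ⟨hxK, subset_tsupport _ fun h0 => hne ?_⟩,
      rightInv_add_kerParam h x⟩
    simp [χ, h0]
  refine ⟨mulCompCLM (hχ.comp (kerCoord L).contDiff) hK, fun g => ?_⟩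
  ext y
  rw [fiberIntegralCLM_apply h]
  simp only [fiberIntegral, affineIntegral, mulCompCLM_apply, Function.comp_apply, map_add,
    kerCoord_rightInv h, kerCoord_kerParam, zero_add, LinearMap.coe_toContinuousLinearMap',
    toEuclideanLin_rightInv h, toEuclideanLin_kerParam, add_zero]
  rw [integral_mul_const, hint, Complex.real_smul, ← mul_assoc, ← Complex.ofReal_mul,
    inv_mul_cancel₀ hc, Complex.ofReal_one, one_mul]

/-- The coordinates `(y, t) ↦ Lᵀ (L Lᵀ)⁻¹ y + ∑ i, t i • v i`. -/
def fiberEquiv (h : (L * L.transpose).det ≠ 0) :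
    (E m × E (Module.finrank ℝ (kerSubspace L))) ≃L[ℝ] E n :=
  ContinuousLinearEquiv.equivOfInverse ((rightInv L).coprod (kerParam L))
    ((Matrix.toEuclideanLin L).toContinuousLinearMap.prod (kerCoord L))
    (fun p => by
      ext1
      · simp [toEuclideanLin_rightInv h, toEuclideanLin_kerParam]
      · simp [kerCoord_rightInv h, kerCoord_kerParam])
    (fun x => by simpa using rightInv_add_kerParam h x)

/-- Uniqueness of Haar measure replaces a Jacobian computation: only `c ≠ 0` matters later. -/
theorem exists_integral_affine_eq (h : (L * L.transpose).det ≠ 0) :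
    ∃ c : ℝ, c ≠ 0 ∧ ∀ f : E n → ℂ, Continuous f → HasCompactSupport f →
      ∫ y, affineIntegral (rightInv L) (kerParam L) f y = c • ∫ x, f x := by
  let μ : Measure (E n) := ((volume : Measure (E m)).prod volume).map (fiberEquiv h)
  have hμ : μ.IsAddHaarMeasure := (fiberEquiv h).isAddHaarMeasure_map _
  let c := μ.addHaarScalarFactor (volume : Measure (E n))
  have hc : μ = c • volume := Measure.isAddLeftInvariant_eq_smul μ volume
  refine ⟨c, ?_, fun f hf hs => ?_⟩
  · exact_mod_cast (Measure.addHaarScalarFactor_pos_of_isAddHaarMeasure μ volume).ne'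
  · have hi : Integrable (fun p => f (fiberEquiv h p))
        ((volume : Measure (E m)).prod volume) := by
      refine (hf.comp (fiberEquiv h).continuous).integrable_of_hasCompactSupport ?_
      exact hs.comp_homeomorph (fiberEquiv h).toHomeomorph
    have h1 : ∫ x, f x ∂μ = ∫ p, f (fiberEquiv h p) ∂((volume : Measure (E m)).prod volume) :=
      integral_map_equiv (fiberEquiv h).toHomeomorph.toMeasurableEquiv f
    rw [hc, integral_smul_nnreal_measure] at h1
    rw [integral_prod _ hi] at h1
    exact h1.symm

theorem planeWave_transpose (η : E m) (x : E n) :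
    planeWave (Matrix.toEuclideanLin L.transpose η) x
      = planeWave η (Matrix.toEuclideanLin L x) := by
  simp only [planeWave, Matrix.toLpLin_apply, Matrix.mulVec, dotProduct, Matrix.transpose_apply,
    Finset.sum_mul, Finset.mul_sum]
  rw [Finset.sum_comm]
  congr 3
  exact Finset.sum_congr rfl fun i _ => Finset.sum_congr rfl fun j _ => by ring

/-- As `(Lᵀ η) · x = η · L x`, this wave is constant along the fibres of `L` and can be moved inside
the fibre integral; the iterated integral is then a multiple of the full one. -/
theorem exists_pullback_planeWaveDistr (h : (L * L.transpose).det ≠ 0) :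
    ∃ c : ℂ, c ≠ 0 ∧ ∀ η : E m, pullback L (planeWaveDistr η)
      = c • planeWaveDistr (Matrix.toEuclideanLin L.transpose η) := by
  obtain ⟨c, hc, hint⟩ := exists_integral_affine_eq h
  refine ⟨((√(L * L.transpose).det)⁻¹ * c : ℝ), ?_, fun η => DFunLike.ext _ _ fun f => ?_⟩
  · exact_mod_cast mul_ne_zero (inv_ne_zero (sqrt_det_ne_zero h)) hc
  · change planeWaveDistr η (fiberIntegralCLM L f) = _ * planeWaveDistr _ f
    rw [planeWaveDistr_apply, planeWaveDistr_apply]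
    simp only [fiberIntegralCLM_apply h]
    rw [Complex.ofReal_mul, mul_assoc, ← Complex.real_smul (x := c),
      ← hint (fun x => f x * planeWave _ x) (f.continuous.mul (continuous_planeWave _))
        f.hasCompactSupport.mul_right,
      ← integral_const_mul]
    refine integral_congr_ae (.of_forall fun y => ?_)
    simp only [fiberIntegral, affineIntegral, planeWave_transpose, map_add,
      toEuclideanLin_rightInv h, toEuclideanLin_kerParam, add_zero]
    rw [integral_mul_const, Complex.real_smul, mul_assoc]

end Fiber

/-! ### Frequencies in `π` and the rank of `L`. -/

section Frequencies

variable {n m : ℕ} {L : Matrix (Fin m) (Fin n) ℝ} {π : Submodule ℝ (E n)}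

theorem kerSubspace_eq_orthogonal (hL : ∀ x : E n, x ∈ πᗮ ↔ ∀ i, ∑ j, L i j * x j = 0) :
    kerSubspace L = πᗮ := by
  ext x
  rw [hL, LinearMap.mem_ker, PiLp.ext_iff]
  simp [Matrix.toLpLin_apply, Matrix.mulVec, dotProduct]

/-- The range of the adjoint is the orthogonal complement of the kernel, and `πᗮᗮ = π`. -/
theorem mem_iff_exists_transpose (hL : kerSubspace L = πᗮ) (ξ : E n) :
    ξ ∈ π ↔ ∃ η, Matrix.toEuclideanLin L.transpose η = ξ := by
  rw [← Submodule.orthogonal_orthogonal π, ← hL, LinearMap.orthogonal_ker, LinearMap.mem_range,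
    ← Matrix.toEuclideanLin_conjTranspose_eq_adjoint,
    Matrix.conjTranspose_eq_transpose_of_trivial]

theorem det_ne_zero_of_finrank_eq (hL : kerSubspace L = πᗮ) (hm : Module.finrank ℝ π = m) :
    (L * L.transpose).det ≠ 0 := by
  have hsurj : Function.Surjective (Matrix.toEuclideanLin L) := by
    rw [← LinearMap.range_eq_top]
    refine Submodule.eq_top_of_finrank_eq ?_
    have h1 : Module.finrank ℝ (LinearMap.range (Matrix.toEuclideanLin L))
        + Module.finrank ℝ (kerSubspace L) = Module.finrank ℝ (E n) :=
      LinearMap.finrank_range_add_finrank_ker (Matrix.toEuclideanLin L)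
    have h2 := π.finrank_add_finrank_orthogonal
    rw [← hL] at h2
    rw [finrank_euclideanSpace_fin] at h1 h2 ⊢
    omega
  intro hdet
  obtain ⟨v, hv, hLv⟩ := Matrix.exists_mulVec_eq_zero_iff.2 hdet
  rw [← Matrix.conjTranspose_eq_transpose_of_trivial,
    Matrix.self_mul_conjTranspose_mulVec_eq_zero,
    Matrix.conjTranspose_eq_transpose_of_trivial] at hLv
  obtain ⟨x, hx⟩ := hsurj (WithLp.toLp 2 v)
  have hx' : L.mulVec x = v := congrArg WithLp.ofLp hx
  -- Here `Lᵀ v = 0` and `v = L x`, so `v · v = v · L x = (Lᵀ v) · x = 0`.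
  refine hv (dotProduct_self_eq_zero.1 ?_)
  nth_rewrite 2 [← hx']
  rw [Matrix.dotProduct_mulVec, ← Matrix.mulVec_transpose, hLv, zero_dotProduct]

end Frequencies

/-! ### Wave solutions and the wave-pair criterion. -/

section Waves

variable {n m k l d : ℕ} {L : Matrix (Fin m) (Fin n) ℝ} {π : Submodule ℝ (E n)}

/-- The map `δ ↦ δ(L ·) u`, as a linear map. -/
def waveMap (L : Matrix (Fin m) (Fin n) ℝ) (u : Fin k → ℂ) :
    Distr m ℂ →ₗ[ℂ] Distr n (Fin k → ℂ) :=
  (transposeMap (TestFunction.postcompCLM (dotCLM k u))).comp (transposeMap (fiberIntegralCLM L))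

theorem waveMap_apply (L : Matrix (Fin m) (Fin n) ℝ) (u : Fin k → ℂ) (δ : Distr m ℂ) :
    waveMap L u δ = tensorVec (pullback L δ) u :=
  rfl

theorem continuous_waveMap (L : Matrix (Fin m) (Fin n) ℝ) (u : Fin k → ℂ) :
    Continuous (waveMap L u) :=
  (continuous_transposeMap _).comp (continuous_transposeMap _)

/-- A continuous map with a continuous left inverse into a Hausdorff space has closed range. For `u
= 0` no left inverse is at hand, but the range is `{0}`. -/
theorem isClosed_range_waveMap (hdet : (L * L.transpose).det ≠ 0) (u : Fin k → ℂ) :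
    IsClosed (Set.range (waveMap L u)) := by
  by_cases hu : u = 0
  · have : Set.range (waveMap L u) = {0} := by
      refine Set.eq_singleton_iff_unique_mem.2 ⟨⟨0, map_zero _⟩, ?_⟩
      rintro _ ⟨δ, rfl⟩
      refine DFunLike.ext _ _ fun f => ?_
      have hf : TestFunction.postcompCLM (dotCLM k u) f = (0 : TestFn n ℂ) := by
        ext x
        change dotCLM k u (f x) = 0
        simp [hu]
      change pullback L δ (TestFunction.postcompCLM (dotCLM k u) f) = 0
      rw [hf, map_zero]
    rw [this]
    exact isClosed_singleton
  · obtain ⟨j, hj⟩ := Function.ne_iff.1 hu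
    obtain ⟨S, hS⟩ := exists_rightInverse_fiberIntegralCLM hdet
    -- `w` is a right inverse of pairing with `u`, supported on a coordinate where `u` is nonzero.
    let w : ℂ →L[ℂ] (Fin k → ℂ) := (u j)⁻¹ • ContinuousLinearMap.single ℂ (fun _ : Fin k => ℂ) j
    let R : TestFn m ℂ →L[ℂ] TestFn n (Fin k → ℂ) := (TestFunction.postcompCLM w).comp S
    have hR : ∀ g, fiberIntegralCLM L (TestFunction.postcompCLM (dotCLM k u) (R g)) = g := by
      intro g
      have : TestFunction.postcompCLM (dotCLM k u) (R g) = S g := by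
        ext x
        change dotCLM k u ((u j)⁻¹ • Pi.single j (S g x)) = S g x
        rw [map_smul, dotCLM_apply]
        simp only [Pi.single_apply, mul_ite, mul_zero, Finset.sum_ite_eq', Finset.mem_univ,
          if_true, smul_eq_mul]
        exact inv_mul_cancel_left₀ hj _
      rw [this, hS]
    have hleft : ∀ δ, transposeMap R (waveMap L u δ) = δ := fun δ =>
      DFunLike.ext _ _ fun g => congrArg δ (hR g)
    have : Set.range (waveMap L u) = {φ | waveMap L u (transposeMap R φ) = φ} := by
      ext φ
      refine ⟨?_, fun h => ⟨_, h⟩⟩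
      rintro ⟨δ, rfl⟩
      exact congrArg _ (hleft δ)
    rw [this]
    exact isClosed_eq ((continuous_waveMap L u).comp (continuous_transposeMap R)) continuous_id

theorem exists_waveMap_planeWaveDistr (hdet : (L * L.transpose).det ≠ 0) (u : Fin k → ℂ) :
    ∃ c : ℂ, c ≠ 0 ∧ ∀ η : E m, waveMap L u (planeWaveDistr η)
      = c • tensorVec (planeWaveDistr (Matrix.toEuclideanLin L.transpose η)) u := by
  obtain ⟨c, hc, h⟩ := exists_pullback_planeWaveDistr hdet
  refine ⟨c, hc, fun η => ?_⟩
  rw [waveMap_apply, h]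
  exact map_smul (transposeMap _) _ _

/-- Lets both inclusions be checked on single waves. -/
theorem classicalWaves_eq_span (u : Fin k → ℂ) (π : Submodule ℝ (E n)) :
    classicalWaves u π
      = Submodule.span ℂ ((fun ξ => tensorVec (planeWaveDistr ξ) u) '' (π : Set (E n))) := by
  have htensor : ∀ {p : ℕ} (c : Fin p → ℂ) (ξ : Fin p → E n),
      tensorVec (∑ j, c j • planeWaveDistr (ξ j)) u
        = ∑ j, c j • tensorVec (planeWaveDistr (ξ j)) u := fun c ξ => by
    simp only [tensorVec, map_sum, map_smul]
  ext φ
  refine ⟨?_, fun h => ?_⟩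
  · rintro ⟨p, c, ξ, hξ, rfl⟩
    rw [ofFunction_sum_simpleWave, htensor]
    exact Submodule.sum_mem _ fun j _ =>
      Submodule.smul_mem _ _ (Submodule.subset_span ⟨ξ j, hξ j, rfl⟩)
  · obtain ⟨p, c, g, rfl⟩ := Submodule.mem_span_set'.1 h
    choose ξ hξ hg using fun j => (g j).2
    refine ⟨p, c, ξ, hξ, ?_⟩
    rw [ofFunction_sum_simpleWave, htensor]
    simp only [hg]

/-- The wave solutions attached to `(u, π)` are the distributions `δ(L ·) u`. -/
theorem waveSolutions_eq_range (hdet : (L * L.transpose).det ≠ 0) (hL : kerSubspace L = πᗮ)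
    (u : Fin k → ℂ) : waveSolutions u π = Set.range (waveMap L u) := by
  obtain ⟨c, hc, hwave⟩ := exists_waveMap_planeWaveDistr hdet u
  rw [waveSolutions, classicalWaves_eq_span]
  refine Set.Subset.antisymm (closure_minimal ?_ (isClosed_range_waveMap hdet u)) ?_
  · have : Submodule.span ℂ ((fun ξ => tensorVec (planeWaveDistr ξ) u) '' (π : Set (E n)))
        ≤ LinearMap.range (waveMap L u) := by
      refine Submodule.span_le.2 ?_
      rintro _ ⟨ξ, hξ, rfl⟩
      obtain ⟨η, rfl⟩ := (mem_iff_exists_transpose hL ξ).1 hξ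
      exact ⟨c⁻¹ • planeWaveDistr η, by
        rw [map_smul, hwave, smul_smul, inv_mul_cancel₀ hc, one_smul]⟩
    exact this
  · rintro _ ⟨δ, rfl⟩
    refine map_mem_closure (continuous_waveMap L u) (dense_span_planeWaveDistr δ) fun ψ hψ => ?_
    have : Submodule.span ℂ (Set.range (planeWaveDistr (n := m))) ≤ (Submodule.span ℂ
        ((fun ξ => tensorVec (planeWaveDistr ξ) u) '' (π : Set (E n)))).comap (waveMap L u) := by
      refine Submodule.span_le.2 ?_
      rintro _ ⟨η, rfl⟩
      refine Submodule.mem_comap.2 ?_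
      rw [hwave]
      exact Submodule.smul_mem _ _ (Submodule.subset_span
        ⟨_, (mem_iff_exists_transpose hL _).2 ⟨η, rfl⟩, rfl⟩)
    exact this hψ

/-- The map `S ↦ A • (S u)` on scalar distributions, as a linear map. -/
def operatorMap (A : Matrix (Fin l) (Fin k) (MvPolynomial (Fin n) ℂ)) (u : Fin k → ℂ) :
    Distr n ℂ →ₗ[ℂ] Fin l → Distr n ℂ where
  toFun S := applyOperator A (tensorVec S u)
  map_add' S T := by
    ext1 i
    simp only [applyOperator_tensorVec, polyAction_add, smul_add, Finset.sum_add_distrib,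
      Pi.add_apply]
  map_smul' c S := by
    ext1 i
    simp only [applyOperator_tensorVec, polyAction_smul, Finset.smul_sum, smul_comm c,
      Pi.smul_apply, RingHom.id_apply]

theorem continuous_operatorMap (A : Matrix (Fin l) (Fin k) (MvPolynomial (Fin n) ℂ))
    (u : Fin k → ℂ) : Continuous (operatorMap A u) := by
  refine continuous_pi fun i => ?_
  simp only [operatorMap, LinearMap.coe_mk, AddHom.coe_mk, applyOperator_tensorVec]
  exact continuous_finsetSum _ fun j _ =>
    (continuous_const_smul (u j)).comp (continuous_polyAction (A i j))

/-- `(u, π)` is a wave pair if and only if all `δ(L ·) u` solve the system `A`. -/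
theorem isWavePair_iff {A : Matrix (Fin l) (Fin k) (MvPolynomial (Fin n) ℂ)}
    (hA : ∀ i j, (A i j).IsHomogeneous d) (hdet : (L * L.transpose).det ≠ 0)
    (hL : kerSubspace L = πᗮ) (u : Fin k → ℂ) :
    IsWavePair A u π ↔ ∀ δ : Distr m ℂ, IsSolution A (tensorVec (pullback L δ) u) := by
  obtain ⟨c, hc, hpull⟩ := exists_pullback_planeWaveDistr hdet
  have heval : ∀ (η : E m) (i : Fin l),
      operatorMap A u (pullback L (planeWaveDistr η)) i
        = (c * (Complex.I ^ d *
            (evalAt A (Matrix.toEuclideanLin L.transpose η)).mulVec u i)) •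
          planeWaveDistr (Matrix.toEuclideanLin L.transpose η) := fun η i => by
    rw [hpull, map_smul, Pi.smul_apply, mul_smul, ← applyOperator_planeWaveDistr hA]
    rfl
  refine ⟨fun h => ?_, fun h ξ hξ => ?_⟩
  · let T : Distr m ℂ →ₗ[ℂ] Fin l → Distr n ℂ :=
      (operatorMap A u).comp (transposeMap (fiberIntegralCLM L))
    have hT : Continuous T := (continuous_operatorMap A u).comp (continuous_transposeMap _)
    have hspan : Submodule.span ℂ (Set.range (planeWaveDistr (n := m))) ≤ LinearMap.ker T := by
      refine Submodule.span_le.2 ?_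
      rintro _ ⟨η, rfl⟩
      refine funext fun i => (heval η i).trans ?_
      rw [h _ ((mem_iff_exists_transpose hL _).2 ⟨η, rfl⟩)]
      simp
    -- The kernel of `T` is closed and contains the dense span of plane waves.
    exact fun δ => closure_minimal hspan (isClosed_singleton.preimage hT)
      (dense_span_planeWaveDistr δ)
  · obtain ⟨η, rfl⟩ := (mem_iff_exists_transpose hL ξ).1 hξ
    ext i
    have h0 := (heval η i).symm.trans (congrFun (h (planeWaveDistr η)) i)
    rcases smul_eq_zero.1 h0 with h1 | h1
    · simpa [hc] using h1
    · exact absurd h1 (planeWaveDistr_ne_zero _)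

end Waves

end

end WavePairs

theorem mainTheorem1 {n k l d : ℕ}
    (A : Matrix (Fin l) (Fin k) (MvPolynomial (Fin n) ℂ))
    (hA : ∀ i j, (A i j).IsHomogeneous d)
    (u : Fin k → ℂ) (π : Submodule ℝ (EuclideanSpace ℝ (Fin n)))
    (r : ℕ) (hr : Module.finrank ℝ (EuclideanSpace ℝ (Fin n) ⧸ π) = r)
    (L : Matrix (Fin (n - r)) (Fin n) ℝ)
    (hL : ∀ x : EuclideanSpace ℝ (Fin n), x ∈ πᗮ ↔ ∀ i, ∑ j, L i j * x j = 0) :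
    (WavePairs.IsWavePair A u π →
      WavePairs.waveSolutions u π =
        Set.range fun δ : WavePairs.Distr (n - r) ℂ =>
          WavePairs.tensorVec (WavePairs.pullback L δ) u) ∧
    (WavePairs.IsWavePair A u π ↔
      ∀ δ : WavePairs.Distr (n - r) ℂ,
        WavePairs.IsSolution A (WavePairs.tensorVec (WavePairs.pullback L δ) u)) := by
  have hker := WavePairs.kerSubspace_eq_orthogonal hL
  -- The number of linear forms equals `dim π`; this is what gives `L` full row rank.
  have hdim : Module.finrank ℝ π = n - r := by
    have := π.finrank_quotient_add_finrank
    rw [hr, finrank_euclideanSpace_fin] at this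
    omega
  have hdet := WavePairs.det_ne_zero_of_finrank_eq hker hdim
  exact ⟨fun _ => WavePairs.waveSolutions_eq_range hdet hker u,
    WavePairs.isWavePair_iff hA hdet hker u⟩
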